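/- Let $p$ be a prime, let $m,r\ge 1$ be integers, let $G\cong (C_{p^r})^m$ be the direct product of $m$ cyclic groups of order $p^r$, and let $\mathbb F_q$ be a finite field with $q$ elements such that $p\nmid q$ and the class $\bar q$ has order $\varphi(p^r)$ in $U(\mathbb Z/p^r\mathbb Z)$. For a subgroup $H\le G$ put $\widehat H=\frac1{|H|}\sum_{x\in H}x\in\mathbb F_qG$, and for $x\in G$ put $\widehat x=\widehat{\langle x\rangle}$. A minimal code is a minimal nonzero ideal of $\mathbb F_qG$; its weight is the least number of nonzero coefficients of a nonzero element of it. Two codes are $G$-equivalent if the linear extension to $\mathbb F_qG$ of some automorphism of $G$ maps the first onto the second. Consider the elements $\widehat G$ and $e_{K,h,i}=\widehat K\,\bigl(\widehat{h^{p^i}}-\widehat{h^{p^{i-1}}}\bigr)$, where $1\le i\le r$, $K$ is a subgroup of $G$ isomorphic to $(C_{p^r})^{m-1}$, and $h\in G$ is an element of order $p^r$ with $G=\langle h\rangle\times K$. Then: 1. The primitive idempotents of $\mathbb F_qG$ are exactly $\widehat G$ and the elements $e_{K,h,i}$, and the minimal codes of $\mathbb F_qG$ are exactly the ideals generated by these idempotents.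 2. The code generated by $\widehat G$ has dimension $1$ and weight $p^{rm}$. The code generated by $e_{K,h,i}$ has dimension $p^{i-1}(p-1)$ and weight $2p^{r(m-1)+(r-i)}$. 3. The number of $G$-equivalence classes of minimal codes of $\mathbb F_qG$ is exactly $r+1=\tau(p^r)$, where $\tau(n)$ denotes the number of positive divisors of $n$. -/

import Mathlib

namespace AbelianCodes

/-- An idempotent `e ≠ 0` that is not a sum of two nonzero orthogonal idempotents. -/
def IsPrimitiveIdempotent {R : Type*} [Ring R] (e : R) : Prop :=
  IsIdempotentElem e ∧ e ≠ 0 ∧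
    ∀ a b : R, IsIdempotentElem a → IsIdempotentElem b → a * b = 0 → b * a = 0 →
      e = a + b → a = 0 ∨ b = 0

section

variable (F : Type*) [Field F] {G : Type*} [CommGroup G]

/-- `Ĥ = |H|⁻¹ ∑_{h ∈ H} h` in the group algebra, for a finite subgroup `H` of `G`. -/
noncomputable def hat (H : Subgroup G) : MonoidAlgebra F G :=
  (Nat.card H : F)⁻¹ • ∑ᶠ h : H, MonoidAlgebra.single (h : G) (1 : F)

/-- `K̂ · (\widehat{h^{p^i}} - \widehat{h^{p^{i-1}}})`, where `x̂` is the hat of the cyclic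
subgroup generated by `x`; it is used for `1 ≤ i` only. -/
noncomputable def rowIdempotent (p : ℕ) (K : Subgroup G) (h : G) (i : ℕ) : MonoidAlgebra F G :=
  hat F K * (hat F (Subgroup.zpowers (h ^ p ^ i)) - hat F (Subgroup.zpowers (h ^ p ^ (i - 1))))

end

/-- `G` is isomorphic to the direct product of `k` copies of the cyclic group of order `n`. -/
def IsHomocyclic (n k : ℕ) (G : Type*) [Group G] : Prop :=
  Nonempty (G ≃* (Fin k → Multiplicative (ZMod n)))

/-- `K` is isomorphic to `(C_n)^(m-1)`, `⟨h⟩ ≅ C_n`, and `G` is the internal direct product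
`⟨h⟩ × K` (in an abelian group: `⟨h⟩ K = G` and `⟨h⟩ ∩ K = 1`). -/
def IsSplitting (n m : ℕ) {G : Type*} [CommGroup G] (K : Subgroup G) (h : G) : Prop :=
  IsHomocyclic n (m - 1) K ∧ orderOf h = n ∧ IsCompl (Subgroup.zpowers h) K

section

variable {F : Type*} [Field F] {G : Type*} [CommGroup G]

/-- A minimal code: a minimal nonzero ideal of the group algebra. -/
def IsMinimalCode (I : Ideal (MonoidAlgebra F G)) : Prop := IsAtom I

/-- The dimension of a code over `F`. -/
noncomputable def codeDim (I : Ideal (MonoidAlgebra F G)) : ℕ :=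
  Module.finrank F (I.restrictScalars F)

/-- The Hamming weight of an element of the group algebra: the size of its support. -/
def hammingWeight (x : MonoidAlgebra F G) : ℕ := x.coeff.support.card

/-- `w` is the weight of the code `I`: the least Hamming weight of a nonzero element. -/
def HasWeight (I : Ideal (MonoidAlgebra F G)) (w : ℕ) : Prop :=
  IsLeast {k : ℕ | ∃ x ∈ I, x ≠ 0 ∧ hammingWeight x = k} w

/-- Two codes are `G`-equivalent if the linear extension of some automorphism of `G` maps the
first onto the second. -/
def GEquivalent (I J : Ideal (MonoidAlgebra F G)) : Prop :=
  ∃ ψ : G ≃* G, MonoidAlgebra.domCongr F F ψ '' (I : Set (MonoidAlgebra F G)) = J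

theorem GEquivalent.refl (I : Ideal (MonoidAlgebra F G)) : GEquivalent I I :=
  ⟨MulEquiv.refl G, by simp⟩

theorem GEquivalent.symm {I J : Ideal (MonoidAlgebra F G)} (h : GEquivalent I J) :
    GEquivalent J I := by
  obtain ⟨ψ, hψ⟩ := h
  refine ⟨ψ.symm, ?_⟩
  rw [← hψ, ← MonoidAlgebra.domCongr_symm, Set.image_image]
  simp only [AlgEquiv.symm_apply_apply, Set.image_id']

theorem GEquivalent.trans {I J L : Ideal (MonoidAlgebra F G)} (h : GEquivalent I J)
    (h' : GEquivalent J L) : GEquivalent I L := by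
  obtain ⟨ψ, hψ⟩ := h
  obtain ⟨χ, hχ⟩ := h'
  refine ⟨ψ.trans χ, ?_⟩
  rw [← hχ, ← hψ, ← MonoidAlgebra.trans_domCongr_domCongr, Set.image_image]
  rfl

end

/-- `G`-equivalence on the set of minimal codes of the group algebra `F G`. -/
def minimalCodeSetoid (F : Type*) [Field F] (G : Type*) [CommGroup G] :
    Setoid {I : Ideal (MonoidAlgebra F G) // IsMinimalCode I} where
  r I J := GEquivalent I.1 J.1
  iseqv := ⟨fun I => GEquivalent.refl I.1, GEquivalent.symm, GEquivalent.trans⟩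

end AbelianCodes

/-
Every maximal ideal of `F G` is the kernel of an evaluation at a character of `G` in a field. The
values of such a character on a basis of `G` are `p`-power roots of unity, so they are powers of
the value of largest order, taken at `h` say; hence the character is trivial on a complement `K` of
`⟨h⟩`, and it maps `Ĝ` or `e_{K,h,i}` to `1`, according to whether the order of its value at `h` is
`1` or `p ^ i`. A family of idempotents that generate minimal ideals and are not all contained in
any maximal ideal contains every primitive idempotent.

Multiplication by `e_{K,h,i}` identifies `k ∈ K` with `1` and makes `h` a root of the cyclotomic
polynomial of order `p ^ i`, which is irreducible over `F`, so the ideal of `e_{K,h,i}` is a copy of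
the corresponding cyclotomic field. Its elements are constant on the cosets of `K ⟨h ^ p ^ i⟩` and
have augmentation `0`, so the support of a nonzero one contains at least two cosets.
-/

namespace AbelianCodes

open MonoidAlgebra Subgroup

section PrimitiveIdempotents

variable {R : Type*} [CommRing R] {e f : R}

theorem IsPrimitiveIdempotent.mul_eq_left (he : IsPrimitiveIdempotent e) (hf : IsIdempotentElem f)
    (hef : e * f ≠ 0) : e * f = e := by
  have horth : e * f * (e * (1 - f)) = 0 := by linear_combination -(e * e) * hf.eq
  have hsplit := he.2.2 (e * f) (e * (1 - f)) (he.1.mul hf) (he.1.mul hf.one_sub) horth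
    (by rw [mul_comm, horth]) (by ring)
  linear_combination -(hsplit.resolve_left hef)

theorem IsPrimitiveIdempotent.eq_of_mul_ne_zero (he : IsPrimitiveIdempotent e)
    (hf : IsPrimitiveIdempotent f) (hef : e * f ≠ 0) : e = f := by
  rw [← he.mul_eq_left hf.1 hef, mul_comm, hf.mul_eq_left he.1 (by rwa [mul_comm])]

theorem isPrimitiveIdempotent_of_isAtom (he : IsIdempotentElem e)
    (hatom : IsAtom (Ideal.span {e})) : IsPrimitiveIdempotent e := by
  refine ⟨he, by simpa using hatom.1, fun a b ha hb _ hba heab =>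
    or_iff_not_imp_left.2 fun ha0 => ?_⟩
  have hae : e * a = a := by rw [heab, add_mul, ha.eq, hba, add_zero]
  have hspan : Ideal.span {a} = Ideal.span {e} :=
    (hatom.le_iff.1 (Ideal.span_singleton_le_span_singleton.2 ⟨a, hae.symm⟩)).resolve_left
      (by simpa using ha0)
  obtain ⟨z, hz⟩ := Ideal.span_singleton_le_span_singleton.1 hspan.ge
  linear_combination -hb.eq - b * heab + b * hz + (z - 1) * hba

theorem eq_of_isAtom_of_mul_ne_zero {I J : Ideal R} (hI : IsAtom I) (hJ : IsAtom J) {x y : R}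
    (hx : x ∈ I) (hy : y ∈ J) (hxy : x * y ≠ 0) : I = J := by
  by_contra hne
  exact hxy (Ideal.mem_bot.1 ((hI.disjoint_of_ne hJ hne).le_bot
    ⟨I.mul_mem_right y hx, J.mul_mem_left x hy⟩))

variable {S : Set R}

theorem exists_mul_ne_zero_of_forall_isMaximal
    (hmax : ∀ M : Ideal R, M.IsMaximal → ∃ e ∈ S, e ∉ M) {x : R} (hx : x ≠ 0) :
    ∃ e ∈ S, x * e ≠ 0 := by
  obtain ⟨M, hM, hle⟩ := Ideal.exists_le_maximal (Ideal.torsionOf R R x)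
    ((Ideal.torsionOf_eq_top_iff R x).not.2 hx)
  obtain ⟨e, he, heM⟩ := hmax M hM
  exact ⟨e, he, fun h0 => heM (hle ((Ideal.mem_torsionOf_iff x e).2 (by
    rw [smul_eq_mul, mul_comm, h0])))⟩

theorem isPrimitiveIdempotent_iff_mem (hidem : ∀ e ∈ S, IsIdempotentElem e)
    (hatom : ∀ e ∈ S, IsAtom (Ideal.span {e}))
    (hmax : ∀ M : Ideal R, M.IsMaximal → ∃ e ∈ S, e ∉ M) :
    IsPrimitiveIdempotent e ↔ e ∈ S := by
  have hprim : ∀ f ∈ S, IsPrimitiveIdempotent f := fun f hf =>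
    isPrimitiveIdempotent_of_isAtom (hidem f hf) (hatom f hf)
  refine ⟨fun he => ?_, hprim e⟩
  obtain ⟨f, hf, hef⟩ := exists_mul_ne_zero_of_forall_isMaximal hmax he.2.1
  exact he.eq_of_mul_ne_zero (hprim f hf) hef ▸ hf

theorem isAtom_iff_exists_eq_span (hatom : ∀ e ∈ S, IsAtom (Ideal.span {e}))
    (hmax : ∀ M : Ideal R, M.IsMaximal → ∃ e ∈ S, e ∉ M) {I : Ideal R} :
    IsAtom I ↔ ∃ e ∈ S, I = Ideal.span {e} := by
  refine ⟨fun hI => ?_, ?_⟩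
  · obtain ⟨x, hx, hx0⟩ := Submodule.exists_mem_ne_zero_of_ne_bot hI.1
    obtain ⟨e, he, hxe⟩ := exists_mul_ne_zero_of_forall_isMaximal hmax hx0
    exact ⟨e, he, eq_of_isAtom_of_mul_ne_zero hI (hatom e he) hx
      (Ideal.mem_span_singleton_self e) hxe⟩
  · rintro ⟨e, he, rfl⟩
    exact hatom e he

end PrimitiveIdempotents

section PolynomialAnnihilator

open Polynomial

variable {F A : Type*} [Field F] [CommRing A] [Algebra F A] {a e : A} {P : F[X]}

theorem exists_mul_aeval_mul_eq {f : F[X]} (hP : Irreducible P) (hPe : aeval a P * e = 0)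
    (hf : ¬ P ∣ f) : ∃ y : A, y * (aeval a f * e) = e := by
  obtain ⟨u, v, huv⟩ := hP.coprime_iff_not_dvd.2 hf
  have huv' := congrArg (aeval a) huv
  rw [map_add, map_mul, map_mul, map_one] at huv'
  exact ⟨aeval a v, by linear_combination e * huv' - aeval a u * hPe⟩

theorem aeval_mul_eq_zero_iff (hP : Irreducible P) (hPe : aeval a P * e = 0) (he : e ≠ 0)
    {f : F[X]} : aeval a f * e = 0 ↔ P ∣ f := by
  refine ⟨fun hfe => by_contra fun hf => he ?_, ?_⟩
  · obtain ⟨y, hy⟩ := exists_mul_aeval_mul_eq hP hPe hf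
    rw [← hy, hfe, mul_zero]
  · rintro ⟨g, rfl⟩
    rw [map_mul, mul_right_comm, hPe, zero_mul]

theorem isAtom_span_of_aeval_mul_eq_zero (hP : Irreducible P) (hPe : aeval a P * e = 0)
    (he : e ≠ 0) (hgen : ∀ x : A, ∃ f : F[X], x * e = aeval a f * e) :
    IsAtom (Ideal.span {e}) := by
  refine ⟨by simpa using he, fun I hI => by_contra fun hI0 => ?_⟩
  obtain ⟨y, hy, hy0⟩ := Submodule.exists_mem_ne_zero_of_ne_bot hI0
  obtain ⟨x, rfl⟩ := Ideal.mem_span_singleton'.1 (hI.le hy)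
  obtain ⟨f, hf⟩ := hgen x
  rw [hf] at hy hy0
  obtain ⟨z, hz⟩ :=
    exists_mul_aeval_mul_eq hP hPe fun h => hy0 ((aeval_mul_eq_zero_iff hP hPe he).2 h)
  exact hI.not_ge ((Ideal.span_singleton_le_iff_mem I).2 (hz ▸ I.mul_mem_left z hy))

theorem finrank_span_of_aeval_mul_eq_zero (hP : Irreducible P) (hPe : aeval a P * e = 0)
    (he : e ≠ 0) (hgen : ∀ x : A, ∃ f : F[X], x * e = aeval a f * e) :
    Module.finrank F ((Ideal.span {e}).restrictScalars F) = P.natDegree := by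
  let L : F[X] →ₗ[F] A := (LinearMap.mulRight F e).comp (aeval a).toLinearMap
  have hrange : LinearMap.range L = (Ideal.span {e}).restrictScalars F := by
    ext x
    rw [Submodule.restrictScalars_mem, Ideal.mem_span_singleton']
    constructor
    · rintro ⟨f, rfl⟩
      exact ⟨aeval a f, rfl⟩
    · rintro ⟨y, rfl⟩
      obtain ⟨f, hf⟩ := hgen y
      exact ⟨f, hf.symm⟩
  have hker : LinearMap.ker L = (Ideal.span {P}).restrictScalars F := by
    ext f
    rw [Submodule.restrictScalars_mem, Ideal.mem_span_singleton]
    exact aeval_mul_eq_zero_iff hP hPe he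
  rw [← hrange, ← L.quotKerEquivRange.finrank_eq, hker]
  exact finrank_quotient_span_eq_natDegree

end PolynomialAnnihilator

section Hat

variable {F : Type*} [Field F] {G : Type*} [CommGroup G] {H K : Subgroup G}
  {y : MonoidAlgebra F G}

instance neZero_natCast_card_subgroup [NeZero (Nat.card G : F)] : NeZero (Nat.card H : F) :=
  ⟨fun h => NeZero.ne (Nat.card G : F)
    (zero_dvd_iff.1 (h ▸ Nat.cast_dvd_cast H.card_subgroup_dvd_card))⟩

theorem finite_of_neZero_natCast_card (F G : Type*) [Field F] [NeZero (Nat.card G : F)] :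
    Finite G :=
  Nat.finite_of_card_ne_zero fun h => NeZero.ne (Nat.card G : F) (by rw [h, Nat.cast_zero])

theorem coeff_hat (H : Subgroup G) (g : G) [Decidable (g ∈ H)] :
    (hat F H).coeff g = if g ∈ H then (Nat.card H : F)⁻¹ else 0 := by
  classical
  obtain hH | hH := finite_or_infinite H
  · have := Fintype.ofFinite H
    have hdelta (k : H) : (single (k : G) (1 : F)).coeff g = if (k : G) = g then 1 else 0 := by
      rw [coeff_single, Finsupp.single_apply]
    rw [hat, finsum_eq_sum_of_fintype, coeff_smul, coeff_sum, Finsupp.smul_apply,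
      Finsupp.finsetSum_apply, Finset.sum_congr rfl fun k _ => hdelta k, Finset.sum_boole,
      smul_eq_mul]
    split_ifs with hg
    · have hfilter : Finset.univ.filter (fun k : H => (k : G) = g) = {⟨g, hg⟩} := by
        ext
        simp [Subtype.ext_iff]
      rw [hfilter, Finset.card_singleton, Nat.cast_one, mul_one]
    · have hfilter : Finset.univ.filter (fun k : H => (k : G) = g) = ∅ :=
        Finset.filter_false_of_mem fun k _ hk => hg (hk ▸ k.2)
      rw [hfilter, Finset.card_empty, Nat.cast_zero, mul_zero]
  · simp [hat]

theorem single_mul_hat {k : G} (hk : k ∈ H) : single k (1 : F) * hat F H = hat F H := by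
  classical
  ext g
  rw [coeff_single_mul_apply, one_mul, coeff_hat, coeff_hat]
  simp only [H.mul_mem_cancel_left (H.inv_mem hk)]

/-- The subgroup of the elements of `G` that fix `y` under multiplication. -/
noncomputable def fixer (y : MonoidAlgebra F G) : Subgroup G :=
  (MulAction.stabilizer (MonoidAlgebra F G)ˣ y).comap (of F G).toHomUnits

theorem mem_fixer {g : G} : g ∈ fixer y ↔ single g (1 : F) * y = y :=
  Iff.rfl

theorem fixer_mul_le (x y : MonoidAlgebra F G) : fixer y ≤ fixer (x * y) := fun g hg => by
  rw [mem_fixer, mul_left_comm, mem_fixer.1 hg]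

theorem le_fixer_hat (H : Subgroup G) : H ≤ fixer (hat F H) :=
  fun _ => single_mul_hat

theorem hat_mul_eq_self_iff [NeZero (Nat.card H : F)] : hat F H * y = y ↔ H ≤ fixer y := by
  refine ⟨fun h => h ▸ mul_comm y (hat F H) ▸ (le_fixer_hat H).trans (fixer_mul_le _ _),
    fun h => ?_⟩
  have := finite_of_neZero_natCast_card F H
  have := Fintype.ofFinite H
  rw [hat, finsum_eq_sum_of_fintype, smul_mul_assoc, Finset.sum_mul,
    Finset.sum_congr rfl fun k _ => mem_fixer.1 (h k.2), Finset.sum_const, Finset.card_univ,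
    ← Nat.card_eq_fintype_card, ← Nat.cast_smul_eq_nsmul F, inv_smul_smul₀ (NeZero.ne _)]

theorem hat_mul_hat_of_le [NeZero (Nat.card H : F)] (h : H ≤ K) : hat F H * hat F K = hat F K :=
  hat_mul_eq_self_iff.2 (h.trans (le_fixer_hat K))

theorem isIdempotentElem_hat [NeZero (Nat.card H : F)] : IsIdempotentElem (hat F H) :=
  hat_mul_hat_of_le le_rfl

theorem hat_ne_zero [NeZero (Nat.card H : F)] : hat F H ≠ 0 := by
  classical
  intro h
  have h1 := coeff_hat (F := F) H 1
  rw [h, if_pos H.one_mem, coeff_zero, Finsupp.zero_apply] at h1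
  exact inv_ne_zero (NeZero.ne _) h1.symm

theorem fixer_hat [NeZero (Nat.card H : F)] : fixer (hat F H) = H := by
  classical
  refine le_antisymm (fun g hg => by_contra fun hgH => ?_) (le_fixer_hat H)
  have h1 := congrArg (fun x => x.coeff g) (mem_fixer.1 hg)
  simp only [coeff_single_mul_apply, one_mul, inv_mul_cancel, coeff_hat, if_pos H.one_mem,
    if_neg hgH] at h1
  exact inv_ne_zero (NeZero.ne _) h1

theorem hat_injective [NeZero (Nat.card G : F)] :
    Function.Injective (hat F : Subgroup G → MonoidAlgebra F G) :=
  fun H K h => by rw [← fixer_hat (F := F) (H := H), h, fixer_hat]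

theorem hat_mul_hat [NeZero (Nat.card G : F)] (H K : Subgroup G) :
    hat F H * hat F K = hat F (H ⊔ K) := by
  have hfix : hat F (H ⊔ K) * (hat F H * hat F K) = hat F H * hat F K := by
    refine hat_mul_eq_self_iff.2 (sup_le ?_ ((le_fixer_hat K).trans (fixer_mul_le _ _)))
    rw [mul_comm]
    exact (le_fixer_hat H).trans (fixer_mul_le _ _)
  rw [← hfix, mul_comm, mul_assoc, hat_mul_hat_of_le le_sup_right, hat_mul_hat_of_le le_sup_left]

theorem domCongr_hat (ψ : G ≃* G) (H : Subgroup G) :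
    domCongr F F ψ (hat F H) = hat F (H.map ψ.toMonoidHom) := by
  classical
  ext g
  have hcard : Nat.card (H.map ψ.toMonoidHom) = Nat.card H :=
    (Nat.card_congr (H.equivMapOfInjective ψ.toMonoidHom ψ.injective).toEquiv).symm
  rw [coeff_domCongr, coeff_hat, coeff_hat, hcard]
  exact if_congr mem_map_equiv.symm rfl rfl

theorem domCongr_rowIdempotent (ψ : G ≃* G) (p : ℕ) (K : Subgroup G) (h : G) (i : ℕ) :
    domCongr F F ψ (rowIdempotent F p K h i) =
      rowIdempotent F p (K.map ψ.toMonoidHom) (ψ h) i := by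
  simp only [rowIdempotent, map_mul, map_sub, domCongr_hat, MonoidHom.map_zpowers,
    MulEquiv.toMonoidHom_eq_coe, MonoidHom.coe_coe, map_pow]

end Hat

section Characters

variable {F : Type*} [Field F] {G : Type*} [CommGroup G] {H : Subgroup G}
  {R : Type*} [CommRing R] [Algebra F R] {χ : G →* R}

theorem lift_hat_of_le_ker [NeZero (Nat.card H : F)] (h : H ≤ χ.ker) :
    MonoidAlgebra.lift F R G χ (hat F H) = 1 := by
  have := finite_of_neZero_natCast_card F H
  have := Fintype.ofFinite H
  have hone (k : H) : MonoidAlgebra.lift F R G χ (single (k : G) 1) = 1 := by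
    rw [lift_single, one_smul, MonoidHom.mem_ker.1 (h k.2)]
  rw [hat, finsum_eq_sum_of_fintype, map_smul, map_sum, Finset.sum_congr rfl fun k _ => hone k,
    Finset.sum_const, Finset.card_univ, ← Nat.card_eq_fintype_card, ← Nat.cast_smul_eq_nsmul F,
    inv_smul_smul₀ (NeZero.ne _)]

theorem lift_hat_of_not_le_ker [IsDomain R] (h : ¬ H ≤ χ.ker) :
    MonoidAlgebra.lift F R G χ (hat F H) = 0 := by
  obtain ⟨k, hkH, hk⟩ := SetLike.not_le_iff_exists.1 h
  have hfix := congrArg (MonoidAlgebra.lift F R G χ) (single_mul_hat (F := F) hkH)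
  rw [map_mul, lift_single, one_smul] at hfix
  exact by_contra fun h0 => hk (MonoidHom.mem_ker.2 ((mul_eq_right₀ h0).1 hfix))

/-- The augmentation map `∑ a_g g ↦ ∑ a_g` of the group algebra. -/
noncomputable def augmentation : MonoidAlgebra F G →ₐ[F] F :=
  MonoidAlgebra.lift F F G 1

theorem augmentation_hat [NeZero (Nat.card H : F)] : augmentation (hat F H) = 1 :=
  lift_hat_of_le_ker (by rw [MonoidHom.ker_one]; exact le_top)

theorem augmentation_apply (x : MonoidAlgebra F G) :
    augmentation x = ∑ g ∈ x.coeff.support, x.coeff g := by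
  simp [augmentation, MonoidAlgebra.lift_apply, Finsupp.sum]

end Characters

section Weights

open scoped Pointwise

variable {F : Type*} [Field F] {G : Type*} [CommGroup G] {H K : Subgroup G}
  {y : MonoidAlgebra F G}

theorem hammingWeight_sub_le (x y : MonoidAlgebra F G) :
    hammingWeight (x - y) ≤ hammingWeight x + hammingWeight y := by
  classical
  exact (Finset.card_le_card Finsupp.support_sub).trans (Finset.card_union_le _ _)

theorem hammingWeight_single_one_mul (g : G) (x : MonoidAlgebra F G) :
    hammingWeight (single g (1 : F) * x) = hammingWeight x := by
  refine Finset.card_bij (fun a _ => g⁻¹ * a) (fun a ha => ?_) (fun a _ b _ => mul_left_cancel)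
    fun a ha => ⟨g * a, ?_, inv_mul_cancel_left g a⟩
  · simpa [coeff_single_mul_apply] using ha
  · simpa [coeff_single_mul_apply] using ha

theorem hammingWeight_hat [NeZero (Nat.card H : F)] : hammingWeight (hat F H) = Nat.card H := by
  classical
  have hsupp : ((hat F H).coeff.support : Set G) = H := by
    ext g
    simp [coeff_hat, NeZero.ne (Nat.card H : F), -Nat.card_eq_fintype_card]
  rw [hammingWeight, ← Set.ncard_coe_finset, hsupp]
  exact Nat.card_coe_set_eq _

theorem coeff_eq_of_mk_eq (hy : H ≤ fixer y) {a b : G} (h : (a : G ⧸ H) = b) :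
    y.coeff a = y.coeff b := by
  conv_rhs => rw [← mem_fixer.1 (hy (QuotientGroup.eq.1 h)), coeff_single_mul_apply, one_mul]
  rw [mul_inv_rev, inv_inv, mul_right_comm, inv_mul_cancel, one_mul]

theorem hammingWeight_eq_card_mul_card_image [DecidableEq (G ⧸ H)] (hy : H ≤ fixer y) :
    hammingWeight y =
      Nat.card H * (y.coeff.support.image (QuotientGroup.mk : G → G ⧸ H)).card := by
  have hfiber : ∀ c ∈ y.coeff.support.image (QuotientGroup.mk : G → G ⧸ H),
      (y.coeff.support.filter fun a : G => (a : G ⧸ H) = c).card = Nat.card H := by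
    intro c hc
    obtain ⟨g, hg, rfl⟩ := Finset.mem_image.1 hc
    have hcoset : ((y.coeff.support.filter fun a : G => (a : G ⧸ H) = g : Finset G) : Set G) =
        g • (H : Set G) := by
      ext a
      rw [Finset.mem_coe, Finset.mem_filter, and_iff_right_of_imp, mem_leftCoset_iff,
        SetLike.mem_coe, eq_comm, QuotientGroup.eq]
      intro ha
      rw [Finsupp.mem_support_iff] at hg ⊢
      rwa [coeff_eq_of_mk_eq hy ha]
    rw [← Set.ncard_coe_finset, hcoset, Set.ncard_smul_set]
    exact Nat.card_coe_set_eq _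
  rw [hammingWeight, Finset.card_eq_sum_card_image (QuotientGroup.mk : G → G ⧸ H),
    Finset.sum_const_nat hfiber, mul_comm]

theorem card_le_hammingWeight (hy : H ≤ fixer y) (hy0 : y ≠ 0) : Nat.card H ≤ hammingWeight y := by
  classical
  rw [hammingWeight_eq_card_mul_card_image hy]
  refine Nat.le_mul_of_pos_right _ (Finset.card_pos.2 (Finset.Nonempty.image ?_ _))
  exact Finsupp.support_nonempty_iff.2 fun h => hy0 (coeff_inj.1 h)

theorem two_mul_card_le_hammingWeight [NeZero (Nat.card H : F)] (hy : H ≤ fixer y) (hy0 : y ≠ 0)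
    (haug : augmentation y = 0) : 2 * Nat.card H ≤ hammingWeight y := by
  classical
  obtain ⟨g, hg⟩ := Finsupp.support_nonempty_iff.2 fun h => hy0 (coeff_inj.1 h)
  have hweight := hammingWeight_eq_card_mul_card_image hy
  rw [hweight, mul_comm]
  refine Nat.mul_le_mul_left _ (Nat.succ_le_of_lt (not_le.1 fun hle => ?_))
  -- Otherwise `y` is a nonzero multiple of a translate of `hat F H`, whose augmentation is `1`.
  have hconst : ∀ a ∈ y.coeff.support, y.coeff a = y.coeff g := fun a ha =>
    coeff_eq_of_mk_eq hy (Finset.card_le_one.1 hle _ (Finset.mem_image_of_mem _ ha) _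
      (Finset.mem_image_of_mem _ hg))
  have hone := hle.antisymm (Finset.card_pos.2 ⟨_, Finset.mem_image_of_mem _ hg⟩)
  rw [augmentation_apply, Finset.sum_congr rfl hconst, Finset.sum_const, ← hammingWeight, hweight,
    hone, mul_one, nsmul_eq_mul] at haug
  exact mul_ne_zero (NeZero.ne _) (Finsupp.mem_support_iff.1 hg) haug

theorem hasWeight_span_hat [NeZero (Nat.card H : F)] :
    HasWeight (Ideal.span {hat F H}) (Nat.card H) := by
  refine ⟨⟨_, Ideal.mem_span_singleton_self _, hat_ne_zero, hammingWeight_hat⟩, ?_⟩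
  rintro _ ⟨y, hy, hy0, rfl⟩
  obtain ⟨z, rfl⟩ := Ideal.mem_span_singleton'.1 hy
  exact card_le_hammingWeight ((le_fixer_hat H).trans (fixer_mul_le _ _)) hy0

theorem hasWeight_span_hat_sub_hat [NeZero (Nat.card G : F)] (h : H < K) :
    HasWeight (Ideal.span {hat F H - hat F K}) (2 * Nat.card H) := by
  have hlower : ∀ y ∈ Ideal.span {hat F H - hat F K}, y ≠ 0 → 2 * Nat.card H ≤ hammingWeight y := by
    intro y hy hy0
    obtain ⟨z, rfl⟩ := Ideal.mem_span_singleton'.1 hy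
    refine two_mul_card_le_hammingWeight ((hat_mul_eq_self_iff (F := F)).1 ?_) hy0 ?_
    · rw [mul_left_comm, mul_sub, isIdempotentElem_hat.eq, hat_mul_hat_of_le h.le]
    · rw [map_mul, map_sub, augmentation_hat, augmentation_hat, sub_self, mul_zero]
  obtain ⟨x, hxK, hxH⟩ := SetLike.exists_of_lt h
  have hmem : hat F H - single x 1 * hat F H ∈ Ideal.span {hat F H - hat F K} :=
    Ideal.mem_span_singleton'.2 ⟨1 - single x (1 : F), by
      linear_combination single_mul_hat (F := F) hxK⟩
  have hne : hat F H - single x 1 * hat F H ≠ 0 := by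
    rw [sub_ne_zero]
    exact fun hfix => hxH (fixer_hat (F := F) (H := H) ▸ mem_fixer.2 hfix.symm)
  have hupper : hammingWeight (hat F H - single x 1 * hat F H) ≤ 2 * Nat.card H := by
    refine (hammingWeight_sub_le _ _).trans_eq ?_
    rw [hammingWeight_single_one_mul, hammingWeight_hat, two_mul]
  refine ⟨⟨_, hmem, hne, hupper.antisymm (hlower _ hmem hne)⟩, ?_⟩
  rintro _ ⟨y, hy, hy0, rfl⟩
  exact hlower y hy hy0

end Weights

section Splittings

variable {G : Type*} [CommGroup G] {H K : Subgroup G} {h : G} {n m p r i : ℕ}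

/-- The subgroup `K ⟨h ^ p ^ i⟩`. The idempotent `rowIdempotent F p K h i` is the difference of the
hats of two consecutive terms of this descending chain. -/
def rowSubgroup (p : ℕ) (K : Subgroup G) (h : G) (i : ℕ) : Subgroup G :=
  K ⊔ zpowers (h ^ p ^ i)

theorem rowSubgroup_antitone (p : ℕ) (K : Subgroup G) (h : G) : Antitone (rowSubgroup p K h) := by
  intro i j hij
  refine sup_le_sup_left (zpowers_le.2 ?_) K
  obtain ⟨c, hc⟩ := pow_dvd_pow p hij
  rw [hc, pow_mul]
  exact npow_mem_zpowers _ c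

theorem card_sup_of_disjoint (h : Disjoint H K) :
    Nat.card (H ⊔ K : Subgroup G) = Nat.card H * Nat.card K := by
  have hchain := relIndex_mul_relIndex ⊥ K (H ⊔ K) bot_le le_sup_right
  rw [relIndex_bot_left, relIndex_bot_left, relIndex_sup_right, ← inf_relIndex_right,
    h.symm.eq_bot, relIndex_bot_left] at hchain
  rw [← hchain, mul_comm]

theorem IsHomocyclic.card_eq (h : IsHomocyclic n m G) : Nat.card G = n ^ m := by
  obtain ⟨f⟩ := h
  rw [Nat.card_congr f.toEquiv, Nat.card_fun, Nat.card_congr Multiplicative.toAdd, Nat.card_zmod,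
    Nat.card_fin]

theorem IsSplitting.card_rowSubgroup (hs : IsSplitting (p ^ r) m K h) (hp : p ≠ 0) (hi : i ≤ r) :
    Nat.card (rowSubgroup p K h i) = p ^ (r * (m - 1) + (r - i)) := by
  obtain ⟨hK, ho, hc⟩ := hs
  have hle : zpowers (h ^ p ^ i) ≤ zpowers h := zpowers_le.2 (npow_mem_zpowers h _)
  rw [rowSubgroup, card_sup_of_disjoint (hc.disjoint.mono_left hle).symm, hK.card_eq,
    Nat.card_zpowers, orderOf_pow_of_dvd (pow_ne_zero _ hp) (ho ▸ pow_dvd_pow p hi), ho,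
    Nat.pow_div hi (Nat.pos_of_ne_zero hp), ← pow_mul, ← pow_add]

theorem IsSplitting.rowSubgroup_lt (hs : IsSplitting (p ^ r) m K h) (hp : 1 < p) (hi₁ : 1 ≤ i)
    (hi : i ≤ r) : rowSubgroup p K h i < rowSubgroup p K h (i - 1) := by
  refine lt_of_le_of_ne (rowSubgroup_antitone p K h (Nat.sub_le i 1)) fun heq => ?_
  have hcard := hs.card_rowSubgroup hp.ne_bot hi
  rw [heq, hs.card_rowSubgroup hp.ne_bot ((Nat.sub_le i 1).trans hi)] at hcard
  have := Nat.pow_right_injective hp hcard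
  omega

theorem exists_eq_pow_mul_of_sup_eq_top (hh : IsOfFinOrder h) (htop : zpowers h ⊔ K = ⊤) (g : G) :
    ∃ t : ℕ, ∃ k ∈ K, g = h ^ t * k := by
  obtain ⟨x, hx, k, hk, rfl⟩ := mem_sup.1 (htop ▸ mem_top g)
  obtain ⟨t, rfl⟩ := hh.mem_powers_iff_mem_zpowers.2 hx
  exact ⟨t, k, hk, rfl⟩

end Splittings

section RowIdempotents

open Polynomial

variable {F : Type*} [Field F] {G : Type*} [CommGroup G] {K : Subgroup G} {h : G} {m p r i : ℕ}

theorem exists_mul_eq_aeval_mul {e : MonoidAlgebra F G} (hh : IsOfFinOrder h)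
    (htop : zpowers h ⊔ K = ⊤) (he : K ≤ fixer e) (x : MonoidAlgebra F G) :
    ∃ f : F[X], x * e = aeval (single h (1 : F)) f * e := by
  induction x using MonoidAlgebra.induction_linear with
  | zero => exact ⟨0, by rw [map_zero]⟩
  | add x y hx hy =>
    obtain ⟨f, hf⟩ := hx
    obtain ⟨g, hg⟩ := hy
    exact ⟨f + g, by rw [add_mul, hf, hg, map_add, add_mul]⟩
  | single g a =>
    obtain ⟨t, k, hk, rfl⟩ := exists_eq_pow_mul_of_sup_eq_top hh htop g
    have hsplit : single (h ^ t * k) a = a • single h (1 : F) ^ t * single k (1 : F) := by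
      rw [single_pow, one_pow, smul_single, single_mul_single, smul_eq_mul, mul_one, mul_one]
    refine ⟨a • X ^ t, ?_⟩
    rw [hsplit, mul_assoc, mem_fixer.1 (he hk), map_smul, aeval_X_pow]

theorem geom_sum_mul_hat_sub_hat [NeZero (Nat.card G : F)] (x : G) (n : ℕ) :
    (∑ s ∈ Finset.range n, single x (1 : F) ^ s) *
      (hat F (zpowers (x ^ n)) - hat F (zpowers x)) = 0 := by
  set T := ∑ s ∈ Finset.range n, single x (1 : F) ^ s
  have hgeom : T * (single x 1 - 1) = single (x ^ n) 1 - 1 := by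
    rw [geom_sum_mul, single_pow, one_pow]
  have hpow : single (x ^ n) (1 : F) * hat F (zpowers (x ^ n)) = hat F (zpowers (x ^ n)) :=
    single_mul_hat (mem_zpowers _)
  have hfix : zpowers x ≤ fixer (T * hat F (zpowers (x ^ n))) := by
    rw [zpowers_le, mem_fixer]
    linear_combination hat F (zpowers (x ^ n)) * hgeom + hpow
  have habsorb : hat F (zpowers (x ^ n)) * hat F (zpowers x) = hat F (zpowers x) :=
    hat_mul_hat_of_le (zpowers_le.2 (npow_mem_zpowers x n))
  linear_combination T * habsorb - hat_mul_eq_self_iff.2 hfix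

theorem aeval_cyclotomic_mul_rowIdempotent [NeZero (Nat.card G : F)] (hp : p.Prime) (K : Subgroup G)
    (h : G) (hi : 1 ≤ i) :
    aeval (single h (1 : F)) (cyclotomic (p ^ i) F) * rowIdempotent F p K h i = 0 := by
  obtain ⟨j, rfl⟩ := Nat.exists_eq_add_of_le' hi
  have hcyc : aeval (single h (1 : F)) (cyclotomic (p ^ (j + 1)) F) =
      ∑ s ∈ Finset.range p, single (h ^ p ^ j) (1 : F) ^ s := by
    simp only [cyclotomic_prime_pow_eq_geom_sum hp, map_sum, map_pow, aeval_X, single_pow, one_pow]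
  rw [hcyc, rowIdempotent, Nat.add_sub_cancel, mul_left_comm, pow_succ, pow_mul,
    geom_sum_mul_hat_sub_hat, mul_zero]

theorem le_fixer_rowIdempotent (p : ℕ) (K : Subgroup G) (h : G) (i : ℕ) :
    K ≤ fixer (rowIdempotent F p K h i) := by
  rw [rowIdempotent, mul_comm]
  exact (le_fixer_hat K).trans (fixer_mul_le _ _)

theorem exists_mul_hat_top_eq_aeval_mul (x : MonoidAlgebra F G) :
    ∃ f : F[X], x * hat F ⊤ = aeval (single (1 : G) (1 : F)) f * hat F ⊤ :=
  exists_mul_eq_aeval_mul IsOfFinOrder.one (sup_top_eq _) (le_fixer_hat ⊤) x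

theorem aeval_X_sub_C_one_mul_hat_top :
    aeval (single (1 : G) (1 : F)) (X - C (1 : F)) * hat F ⊤ = 0 := by
  rw [map_sub, aeval_X, aeval_C, map_one, ← one_def, sub_self, zero_mul]

variable [NeZero (Nat.card G : F)]

theorem isAtom_span_hat_top : IsAtom (Ideal.span {hat F (⊤ : Subgroup G)}) :=
  isAtom_span_of_aeval_mul_eq_zero (irreducible_X_sub_C 1) aeval_X_sub_C_one_mul_hat_top hat_ne_zero
    exists_mul_hat_top_eq_aeval_mul

theorem codeDim_span_hat_top : codeDim (Ideal.span {hat F (⊤ : Subgroup G)}) = 1 := by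
  rw [← natDegree_X_sub_C (1 : F)]
  exact finrank_span_of_aeval_mul_eq_zero (irreducible_X_sub_C 1) aeval_X_sub_C_one_mul_hat_top
    hat_ne_zero exists_mul_hat_top_eq_aeval_mul

theorem rowIdempotent_eq_hat_sub_hat (p : ℕ) (K : Subgroup G) (h : G) (i : ℕ) :
    rowIdempotent F p K h i = hat F (rowSubgroup p K h i) - hat F (rowSubgroup p K h (i - 1)) := by
  rw [rowIdempotent, mul_sub, hat_mul_hat, hat_mul_hat, rowSubgroup, rowSubgroup]

theorem isIdempotentElem_rowIdempotent (p : ℕ) (K : Subgroup G) (h : G) (i : ℕ) :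
    IsIdempotentElem (rowIdempotent F p K h i) := by
  have habsorb : hat F (rowSubgroup p K h i) * hat F (rowSubgroup p K h (i - 1)) =
      hat F (rowSubgroup p K h (i - 1)) :=
    hat_mul_hat_of_le (rowSubgroup_antitone p K h (Nat.sub_le i 1))
  rw [rowIdempotent_eq_hat_sub_hat]
  exact isIdempotentElem_hat.sub isIdempotentElem_hat (by rw [mul_comm, habsorb]) habsorb

theorem augmentation_rowIdempotent (p : ℕ) (K : Subgroup G) (h : G) (i : ℕ) :
    augmentation (rowIdempotent F p K h i) = 0 := by
  simp only [rowIdempotent, map_mul, map_sub, augmentation_hat, sub_self, mul_zero]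

namespace IsSplitting

variable (hs : IsSplitting (p ^ r) m K h)
include hs

theorem rowIdempotent_ne_zero (hp : 1 < p) (hi₁ : 1 ≤ i) (hi : i ≤ r) :
    rowIdempotent F p K h i ≠ 0 := by
  rw [rowIdempotent_eq_hat_sub_hat, sub_ne_zero]
  exact hat_injective.ne (hs.rowSubgroup_lt hp hi₁ hi).ne

theorem exists_mul_rowIdempotent_eq_aeval_mul (x : MonoidAlgebra F G) :
    ∃ f : F[X], x * rowIdempotent F p K h i =
      aeval (single h (1 : F)) f * rowIdempotent F p K h i := by
  have := finite_of_neZero_natCast_card F G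
  exact exists_mul_eq_aeval_mul (isOfFinOrder_of_finite h) hs.2.2.sup_eq_top
    (le_fixer_rowIdempotent p K h i) x

theorem isAtom_span_rowIdempotent (hp : p.Prime) (hirr : Irreducible (cyclotomic (p ^ i) F))
    (hi₁ : 1 ≤ i) (hi : i ≤ r) : IsAtom (Ideal.span {rowIdempotent F p K h i}) :=
  isAtom_span_of_aeval_mul_eq_zero hirr (aeval_cyclotomic_mul_rowIdempotent hp K h hi₁)
    (hs.rowIdempotent_ne_zero hp.one_lt hi₁ hi) hs.exists_mul_rowIdempotent_eq_aeval_mul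

theorem codeDim_span_rowIdempotent (hp : p.Prime) (hirr : Irreducible (cyclotomic (p ^ i) F))
    (hi₁ : 1 ≤ i) (hi : i ≤ r) :
    codeDim (Ideal.span {rowIdempotent F p K h i}) = p ^ (i - 1) * (p - 1) := by
  rw [codeDim, finrank_span_of_aeval_mul_eq_zero hirr
    (aeval_cyclotomic_mul_rowIdempotent hp K h hi₁) (hs.rowIdempotent_ne_zero hp.one_lt hi₁ hi)
    hs.exists_mul_rowIdempotent_eq_aeval_mul, natDegree_cyclotomic, Nat.totient_prime_pow hp hi₁]

theorem hasWeight_span_rowIdempotent (hp : 1 < p) (hi₁ : 1 ≤ i) (hi : i ≤ r) :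
    HasWeight (Ideal.span {rowIdempotent F p K h i}) (2 * p ^ (r * (m - 1) + (r - i))) := by
  rw [rowIdempotent_eq_hat_sub_hat, ← hs.card_rowSubgroup hp.ne_bot hi]
  exact hasWeight_span_hat_sub_hat (hs.rowSubgroup_lt hp hi₁ hi)

end IsSplitting

end RowIdempotents

section Complements

variable {G : Type*} [CommGroup G] {H K : Subgroup G} {h : G} {n m : ℕ}

theorem isComplement'_of_isCompl (h : IsCompl H K) : IsComplement' H K :=
  isComplement'_of_disjoint_and_mul_eq_univ h.disjoint
    (by rw [← mul_normal, h.sup_eq_top, coe_top])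

theorem IsSplitting.of_isCompl (hs : IsSplitting n m K h) (hc : IsCompl (zpowers h) H) :
    IsSplitting n m H h := by
  obtain ⟨⟨f⟩, ho, hcK⟩ := hs
  exact ⟨⟨(isComplement'_of_isCompl hc.symm).QuotientMulEquiv.symm.trans
    ((isComplement'_of_isCompl hcK.symm).QuotientMulEquiv.trans f)⟩, ho, hc⟩

theorem isCompl_zpowers_ker (π : G →* Multiplicative (ZMod n)) (ho : orderOf h = n)
    (hπ : π h = Multiplicative.ofAdd 1) : IsCompl (zpowers h) π.ker := by
  have hzpow (t : ℤ) : π (h ^ t) = Multiplicative.ofAdd (t : ZMod n) := by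
    rw [map_zpow, hπ, ← ofAdd_zsmul, zsmul_one]
  constructor
  · rw [disjoint_def]
    rintro _ ⟨t, rfl⟩ ht
    rw [MonoidHom.mem_ker, hzpow, ofAdd_eq_one, ZMod.intCast_zmod_eq_zero_iff_dvd] at ht
    exact orderOf_dvd_iff_zpow_eq_one.1 (ho ▸ ht)
  · rw [codisjoint_iff, eq_top_iff]
    intro x _
    obtain ⟨t, ht⟩ := ZMod.intCast_surjective (π x).toAdd
    refine mem_sup.2 ⟨h ^ t, ⟨t, rfl⟩, (h ^ t)⁻¹ * x, ?_, mul_inv_cancel_left _ _⟩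
    rw [MonoidHom.mem_ker, map_mul, map_inv, hzpow, ht, ofAdd_toAdd, inv_mul_cancel]

end Complements

section Coordinates

variable {G : Type*} [CommGroup G] {n m : ℕ}

/-- The element of `G` whose coordinates under `f` are those of the `j`-th standard basis vector. -/
def basisElement {ι : Type*} [DecidableEq ι] (f : G ≃* (ι → Multiplicative (ZMod n))) (j : ι) : G :=
  f.symm (Pi.mulSingle j (Multiplicative.ofAdd 1))

section

variable {ι : Type*} [DecidableEq ι] (f : G ≃* (ι → Multiplicative (ZMod n))) (j : ι)

theorem apply_basisElement : f (basisElement f j) = Pi.mulSingle j (Multiplicative.ofAdd 1) :=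
  f.apply_symm_apply _

theorem orderOf_basisElement : orderOf (basisElement f j) = n := by
  rw [basisElement, MulEquiv.orderOf_eq, orderOf_piMulSingle, orderOf_ofAdd_eq_addOrderOf,
    ZMod.addOrderOf_one]

variable {f}

theorem monoidHom_ext_basisElement [Finite ι] {M : Type*} [CommMonoid M] {φ ψ : G →* M}
    (h : ∀ l, φ (basisElement f l) = ψ (basisElement f l)) : φ = ψ := by
  have hcomp : φ.comp f.symm.toMonoidHom = ψ.comp f.symm.toMonoidHom := by
    refine MonoidHom.functions_ext _ _ _ fun l x => ?_
    obtain ⟨t, ht⟩ := ZMod.intCast_surjective x.toAdd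
    have hx : x = Multiplicative.ofAdd 1 ^ t := by rw [← ofAdd_zsmul, zsmul_one, ht, ofAdd_toAdd]
    let axis := f.symm.toMonoidHom.comp (MonoidHom.mulSingle (fun _ => Multiplicative (ZMod n)) l)
    have hl : Multiplicative.ofAdd 1 ∈ (φ.comp axis).eqLocus (ψ.comp axis) := h l
    exact hx ▸ zpow_mem hl t
  exact MonoidHom.ext fun x => by simpa using DFunLike.congr_fun hcomp (f x)

theorem exists_isCompl_zpowers_basisElement_le_ker [Finite ι] {M : Type*} [CommMonoid M]
    (χ : G →* M) (c : ι → ℕ) (hc : ∀ l, χ (basisElement f l) = χ (basisElement f j) ^ c l) :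
    ∃ K : Subgroup G, IsCompl (zpowers (basisElement f j)) K ∧ K ≤ χ.ker := by
  have := Fintype.ofFinite ι
  set d := Function.update c j 1 with hd
  have hχ (l) : χ (basisElement f l) = χ (basisElement f j) ^ d l := by
    obtain rfl | hl := eq_or_ne l j
    · rw [hd, Function.update_self, pow_one]
    · rw [hd, Function.update_of_ne hl, hc]
  let coord (l : ι) : G →* Multiplicative (ZMod n) := (Pi.evalMonoidHom _ l).comp f.toMonoidHom
  let π : G →* Multiplicative (ZMod n) := ∏ l, (powMonoidHom (d l)).comp (coord l)
  let θ : Multiplicative (ZMod n) →* G :=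
    f.symm.toMonoidHom.comp (MonoidHom.mulSingle (fun _ => Multiplicative (ZMod n)) j)
  have hπ (l) : π (basisElement f l) = Multiplicative.ofAdd 1 ^ d l := by
    have hcoord (k) : coord k (basisElement f l) =
        (Pi.mulSingle l (Multiplicative.ofAdd 1) : ι → Multiplicative (ZMod n)) k :=
      congrFun (apply_basisElement f l) k
    rw [MonoidHom.finsetProd_apply, Finset.prod_eq_single l]
    · rw [MonoidHom.comp_apply, hcoord, Pi.mulSingle_eq_same, powMonoidHom_apply]
    · intro k _ hk
      rw [MonoidHom.comp_apply, hcoord, Pi.mulSingle_eq_of_ne hk, map_one]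
    · exact fun hl => absurd (Finset.mem_univ l) hl
  have hfactor : (χ.comp θ).comp π = χ := monoidHom_ext_basisElement fun l => by
    rw [MonoidHom.comp_apply, hπ, map_pow, hχ]
    rfl
  refine ⟨π.ker, isCompl_zpowers_ker π (orderOf_basisElement f j) ?_, fun x hx => ?_⟩
  · rw [hπ, hd, Function.update_self, pow_one]
  · rw [MonoidHom.mem_ker, ← hfactor, MonoidHom.comp_apply, MonoidHom.mem_ker.1 hx, map_one]

end

theorem exists_isSplitting_basisElement (f : G ≃* (Fin (m + 1) → Multiplicative (ZMod n)))
    (j : Fin (m + 1)) : ∃ K : Subgroup G, IsSplitting n (m + 1) K (basisElement f j) := by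
  let π : G →* Multiplicative (ZMod n) := (Pi.evalMonoidHom _ j).comp f.toMonoidHom
  let ρ : π.ker →* (Fin m → Multiplicative (ZMod n)) :=
    { toFun := fun x k => f x (j.succAbove k)
      map_one' := by ext; simp
      map_mul' := fun x y => by ext; simp }
  have hinj : Function.Injective ρ := by
    rw [injective_iff_map_eq_one]
    rintro ⟨x, hx⟩ hρ
    refine Subtype.ext (f.injective ((funext fun l => ?_).trans (map_one f).symm))
    obtain rfl | ⟨k, rfl⟩ := Fin.eq_self_or_eq_succAbove j l
    exacts [hx, congrFun hρ k]
  have hsurj : Function.Surjective ρ := fun y =>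
    ⟨⟨f.symm (j.insertNth 1 y), by simp [π, MonoidHom.mem_ker]⟩, by ext k; simp [ρ]⟩
  refine ⟨π.ker, ⟨MulEquiv.ofBijective ρ ⟨hinj, hsurj⟩⟩, orderOf_basisElement f j,
    isCompl_zpowers_ker π (orderOf_basisElement f j) ?_⟩
  exact (congrFun (apply_basisElement f j) j).trans (Pi.mulSingle_eq_same j _)

theorem exists_isSplitting_le_ker {p r : ℕ} (hp : p.Prime) (hm : 0 < m)
    (hG : IsHomocyclic (p ^ r) m G) {R : Type*} [CommRing R] [IsDomain R] (χ : G →* R) :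
    ∃ (K : Subgroup G) (h : G) (i : ℕ),
      IsSplitting (p ^ r) m K h ∧ K ≤ χ.ker ∧ i ≤ r ∧ orderOf (χ h) = p ^ i := by
  obtain ⟨m, rfl⟩ := Nat.exists_eq_add_of_le' hm
  obtain ⟨f⟩ := hG
  have horder (l) : ∃ i ≤ r, orderOf (χ (basisElement f l)) = p ^ i :=
    (Nat.dvd_prime_pow hp).1 ((orderOf_map_dvd χ _).trans (orderOf_basisElement f l).dvd)
  choose i hi ho using horder
  obtain ⟨j, hj⟩ := Finite.exists_max i
  have : NeZero (p ^ i j) := ⟨pow_ne_zero _ hp.ne_zero⟩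
  have hroot : IsPrimitiveRoot (χ (basisElement f j)) (p ^ i j) := ho j ▸ IsPrimitiveRoot.orderOf _
  have hpow (l) : ∃ c, χ (basisElement f l) = χ (basisElement f j) ^ c := by
    obtain ⟨c, -, hc⟩ := hroot.eq_pow_of_pow_eq_one
      (orderOf_dvd_iff_pow_eq_one.1 ((ho l).dvd.trans (pow_dvd_pow p (hj l))))
    exact ⟨c, hc.symm⟩
  choose c hc using hpow
  obtain ⟨K, hK, hker⟩ := exists_isCompl_zpowers_basisElement_le_ker j χ c hc
  obtain ⟨K₀, hs⟩ := exists_isSplitting_basisElement f j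
  exact ⟨K, _, i j, hs.of_isCompl hK, hker, hi j, ho j⟩

end Coordinates

section Completeness

open Polynomial

variable {F : Type*} [Field F] {G : Type*} [CommGroup G] {p r m : ℕ}

/-- The idempotents `Ĝ` and `e_{K,h,i}` of the group algebra of `G ≅ (C_{p ^ r})^m`. -/
def codeIdempotents (F G : Type*) [Field F] [CommGroup G] (p r m : ℕ) : Set (MonoidAlgebra F G) :=
  {e | e = hat F (⊤ : Subgroup G) ∨ ∃ (K : Subgroup G) (h : G) (i : ℕ),
    IsSplitting (p ^ r) m K h ∧ 1 ≤ i ∧ i ≤ r ∧ e = rowIdempotent F p K h i}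

variable [NeZero (Nat.card G : F)]

theorem lift_rowIdempotent_of_orderOf_eq {R : Type*} [CommRing R] [IsDomain R] [Algebra F R]
    {χ : G →* R} {K : Subgroup G} {h : G} {i : ℕ} (hp : 1 < p) (hi : 1 ≤ i) (hK : K ≤ χ.ker)
    (ho : orderOf (χ h) = p ^ i) : MonoidAlgebra.lift F R G χ (rowIdempotent F p K h i) = 1 := by
  have hker (j : ℕ) : zpowers (h ^ p ^ j) ≤ χ.ker ↔ i ≤ j := by
    rw [zpowers_le, MonoidHom.mem_ker, map_pow, ← orderOf_dvd_iff_pow_eq_one, ho,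
      Nat.pow_dvd_pow_iff_le_right hp]
  rw [rowIdempotent, map_mul, map_sub, lift_hat_of_le_ker hK,
    lift_hat_of_le_ker ((hker i).2 le_rfl),
    lift_hat_of_not_le_ker ((hker (i - 1)).not.2 (by lia)), sub_zero, mul_one]

theorem exists_mem_codeIdempotents_lift_eq_one (hp : p.Prime) (hm : 0 < m)
    (hG : IsHomocyclic (p ^ r) m G) {R : Type*} [CommRing R] [IsDomain R] [Algebra F R]
    (χ : G →* R) : ∃ e ∈ codeIdempotents F G p r m, MonoidAlgebra.lift F R G χ e = 1 := by
  obtain ⟨K, h, i, hs, hK, hi, ho⟩ := exists_isSplitting_le_ker hp hm hG χ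
  obtain rfl | hi₁ := Nat.eq_zero_or_pos i
  · have htop : ⊤ ≤ χ.ker := by
      rw [← hs.2.2.sup_eq_top, sup_le_iff, zpowers_le, MonoidHom.mem_ker, ← orderOf_eq_one_iff, ho]
      exact ⟨pow_zero p, hK⟩
    exact ⟨_, Or.inl rfl, lift_hat_of_le_ker htop⟩
  · exact ⟨_, Or.inr ⟨K, h, i, hs, hi₁, hi, rfl⟩,
      lift_rowIdempotent_of_orderOf_eq hp.one_lt hi₁ hK ho⟩

theorem exists_mem_codeIdempotents_notMem (hp : p.Prime) (hm : 0 < m)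
    (hG : IsHomocyclic (p ^ r) m G) (M : Ideal (MonoidAlgebra F G)) (hM : M.IsMaximal) :
    ∃ e ∈ codeIdempotents F G p r m, e ∉ M := by
  obtain ⟨χ, hχ⟩ := (MonoidAlgebra.lift F (MonoidAlgebra F G ⧸ M) G).surjective
    (Ideal.Quotient.mkₐ F M)
  obtain ⟨e, he, hone⟩ := exists_mem_codeIdempotents_lift_eq_one (F := F) hp hm hG χ
  refine ⟨e, he, fun heM => zero_ne_one (α := MonoidAlgebra F G ⧸ M) ?_⟩
  rw [← hone, hχ, Ideal.Quotient.mkₐ_eq_mk, Ideal.Quotient.eq_zero_iff_mem.2 heM]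

theorem isIdempotentElem_of_mem_codeIdempotents {e : MonoidAlgebra F G}
    (he : e ∈ codeIdempotents F G p r m) : IsIdempotentElem e := by
  obtain rfl | ⟨K, h, i, -, -, -, rfl⟩ := he
  exacts [isIdempotentElem_hat, isIdempotentElem_rowIdempotent p K h i]

theorem isAtom_span_of_mem_codeIdempotents (hp : p.Prime)
    (hirr : Irreducible (cyclotomic (p ^ r) F)) {e : MonoidAlgebra F G}
    (he : e ∈ codeIdempotents F G p r m) : IsAtom (Ideal.span {e}) := by
  obtain rfl | ⟨K, h, i, hs, hi₁, hi, rfl⟩ := he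
  exacts [isAtom_span_hat_top, hs.isAtom_span_rowIdempotent hp
    (cyclotomic_irreducible_pow_of_irreducible_pow hp hi hirr) hi₁ hi]

theorem isPrimitiveIdempotent_iff_mem_codeIdempotents (hp : p.Prime) (hm : 0 < m)
    (hirr : Irreducible (cyclotomic (p ^ r) F)) (hG : IsHomocyclic (p ^ r) m G)
    {e : MonoidAlgebra F G} : IsPrimitiveIdempotent e ↔ e ∈ codeIdempotents F G p r m :=
  isPrimitiveIdempotent_iff_mem (fun _ => isIdempotentElem_of_mem_codeIdempotents)
    (fun _ => isAtom_span_of_mem_codeIdempotents hp hirr)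
    (exists_mem_codeIdempotents_notMem hp hm hG)

theorem isMinimalCode_iff (hp : p.Prime) (hm : 0 < m)
    (hirr : Irreducible (cyclotomic (p ^ r) F)) (hG : IsHomocyclic (p ^ r) m G)
    {I : Ideal (MonoidAlgebra F G)} : IsMinimalCode I ↔
      I = Ideal.span {hat F (⊤ : Subgroup G)} ∨ ∃ (K : Subgroup G) (h : G) (i : ℕ),
        IsSplitting (p ^ r) m K h ∧ 1 ≤ i ∧ i ≤ r ∧ I = Ideal.span {rowIdempotent F p K h i} := by
  refine (isAtom_iff_exists_eq_span (fun _ => isAtom_span_of_mem_codeIdempotents hp hirr)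
    (exists_mem_codeIdempotents_notMem hp hm hG)).trans ⟨?_, ?_⟩
  · rintro ⟨_, rfl | ⟨K, h, i, hs, hi₁, hi, rfl⟩, rfl⟩
    exacts [Or.inl rfl, Or.inr ⟨K, h, i, hs, hi₁, hi, rfl⟩]
  · rintro (rfl | ⟨K, h, i, hs, hi₁, hi, rfl⟩)
    exacts [⟨_, Or.inl rfl, rfl⟩, ⟨_, Or.inr ⟨K, h, i, hs, hi₁, hi, rfl⟩, rfl⟩]

end Completeness

section Equivalence

open Polynomial

variable {F : Type*} [Field F] {G : Type*} [CommGroup G]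

theorem exists_mulEquiv_of_isCompl {H K H' K' : Subgroup G} (hc : IsCompl H K)
    (hc' : IsCompl H' K') (a : H ≃* H') (b : K ≃* K') :
    ∃ ψ : G ≃* G, (∀ x : H, ψ x = a x) ∧ ∀ y : K, ψ y = b y := by
  let prod {A B : Subgroup G} (h : IsCompl A B) : A × B ≃* G :=
    MulEquiv.ofBijective (A.subtype.coprod B.subtype) (isComplement'_of_isCompl h)
  let ψ := (prod hc).symm.trans ((a.prodCongr b).trans (prod hc'))
  have hψ (x : H) (y : K) : ψ (x * y) = a x * b y :=
    congrArg (fun z => prod hc' (a.prodCongr b z)) ((prod hc).symm_apply_apply (x, y))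
  exact ⟨ψ, fun x => by simpa using hψ x 1, fun y => by simpa using hψ 1 y⟩

theorem mem_zpowers_mk_self {A : Type*} [Group A] {a : A} (x : zpowers a) :
    x ∈ zpowers (⟨a, mem_zpowers a⟩ : zpowers a) := by
  obtain ⟨_, t, rfl⟩ := x
  exact ⟨t, rfl⟩

theorem exists_zpowers_mulEquiv_of_orderOf_eq {A B : Type*} [Group A] [Group B] {a : A} {b : B}
    (ho : orderOf a = orderOf b) :
    ∃ f : zpowers a ≃* zpowers b, f ⟨a, mem_zpowers a⟩ = ⟨b, mem_zpowers b⟩ :=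
  ⟨mulEquivOfOrderOfEq mem_zpowers_mk_self mem_zpowers_mk_self (by rw [orderOf_mk, orderOf_mk, ho]),
    mulEquivOfOrderOfEq_apply_gen _ _ _⟩

theorem IsSplitting.exists_mulEquiv {n m : ℕ} {K K' : Subgroup G} {h h' : G}
    (hs : IsSplitting n m K h) (hs' : IsSplitting n m K' h') :
    ∃ ψ : G ≃* G, K.map ψ.toMonoidHom = K' ∧ ψ h = h' := by
  obtain ⟨⟨f⟩, ho, hc⟩ := hs
  obtain ⟨⟨f'⟩, ho', hc'⟩ := hs'
  obtain ⟨a, ha⟩ := exists_zpowers_mulEquiv_of_orderOf_eq (ho.trans ho'.symm)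
  let b : K ≃* K' := f.trans f'.symm
  obtain ⟨ψ, hψa, hψb⟩ := exists_mulEquiv_of_isCompl hc hc' a b
  refine ⟨ψ, le_antisymm ?_ fun y hy => ?_, (hψa ⟨h, mem_zpowers h⟩).trans (by rw [ha])⟩
  · rintro _ ⟨x, hx, rfl⟩
    exact (hψb ⟨x, hx⟩ ▸ (b ⟨x, hx⟩).2 : ψ x ∈ K')
  · refine ⟨b.symm ⟨y, hy⟩, (b.symm ⟨y, hy⟩).2, ?_⟩
    exact (hψb _).trans (by rw [b.apply_symm_apply])

theorem domCongr_image_span (ψ : G ≃* G) (e : MonoidAlgebra F G) :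
    domCongr F F ψ '' (Ideal.span {e} : Ideal (MonoidAlgebra F G)) =
      (Ideal.span {domCongr F F ψ e} : Ideal (MonoidAlgebra F G)) := by
  rw [← Set.image_singleton, ← Ideal.map_span]
  ext x
  exact (Ideal.mem_map_iff_of_surjective _ (domCongr F F ψ).surjective).symm

theorem IsSplitting.gEquivalent_span_rowIdempotent {n m : ℕ} {K K' : Subgroup G} {h h' : G}
    (hs : IsSplitting n m K h) (hs' : IsSplitting n m K' h') (p i : ℕ) :
    GEquivalent (Ideal.span {rowIdempotent F p K h i})
      (Ideal.span {rowIdempotent F p K' h' i}) := by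
  obtain ⟨ψ, rfl, rfl⟩ := hs.exists_mulEquiv hs'
  exact ⟨ψ, by rw [domCongr_image_span, domCongr_rowIdempotent]⟩

theorem GEquivalent.eq_of_span_hat_top {I : Ideal (MonoidAlgebra F G)}
    (h : GEquivalent (Ideal.span {hat F (⊤ : Subgroup G)}) I) :
    I = Ideal.span {hat F (⊤ : Subgroup G)} := by
  obtain ⟨ψ, hψ⟩ := h
  rw [domCongr_image_span, domCongr_hat, map_top_of_surjective _ ψ.surjective] at hψ
  exact SetLike.coe_injective hψ.symm

theorem hammingWeight_domCongr (ψ : G ≃* G) (x : MonoidAlgebra F G) :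
    hammingWeight (domCongr F F ψ x) = hammingWeight x := by
  rw [hammingWeight, domCongr_support, Finset.card_map, hammingWeight]

theorem GEquivalent.hasWeight {I J : Ideal (MonoidAlgebra F G)} (h : GEquivalent I J) {w : ℕ}
    (hI : HasWeight I w) : HasWeight J w := by
  obtain ⟨ψ, hψ⟩ := h
  have hmem (x : MonoidAlgebra F G) : domCongr F F ψ x ∈ J ↔ x ∈ I := by
    rw [← SetLike.mem_coe, ← hψ, (domCongr F F ψ).injective.mem_set_image, SetLike.mem_coe]
  have hiff (k : ℕ) : (∃ y ∈ J, y ≠ 0 ∧ hammingWeight y = k) ↔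
      ∃ x ∈ I, x ≠ 0 ∧ hammingWeight x = k :=
    (domCongr F F ψ).surjective.exists.trans <| exists_congr fun x => by
      rw [hmem, hammingWeight_domCongr, map_ne_zero_iff _ (domCongr F F ψ).injective]
  simpa only [HasWeight, hiff] using hI

variable [NeZero (Nat.card G : F)] {p r m : ℕ} {K : Subgroup G} {h : G}

theorem not_gEquivalent_span_hat_top_span_rowIdempotent (p : ℕ) (K : Subgroup G) (h : G) (i : ℕ) :
    ¬ GEquivalent (Ideal.span {hat F (⊤ : Subgroup G)})
      (Ideal.span {rowIdempotent F p K h i}) := by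
  intro hequiv
  obtain ⟨z, hz⟩ := Ideal.mem_span_singleton'.1
    (hequiv.eq_of_span_hat_top ▸ Ideal.mem_span_singleton_self (hat F (⊤ : Subgroup G)))
  have haug := congrArg augmentation hz
  rw [map_mul, augmentation_rowIdempotent, mul_zero, augmentation_hat] at haug
  exact zero_ne_one haug

theorem IsSplitting.eq_of_gEquivalent_span_rowIdempotent (hs : IsSplitting (p ^ r) m K h)
    (hp : 1 < p) {i j : ℕ} (hi₁ : 1 ≤ i) (hi : i ≤ r) (hj₁ : 1 ≤ j) (hj : j ≤ r)
    (hequiv : GEquivalent (Ideal.span {rowIdempotent F p K h i})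
      (Ideal.span {rowIdempotent F p K h j})) : i = j := by
  have hweight := (hequiv.hasWeight (hs.hasWeight_span_rowIdempotent hp hi₁ hi)).unique
    (hs.hasWeight_span_rowIdempotent hp hj₁ hj)
  have := Nat.pow_right_injective hp (Nat.eq_of_mul_eq_mul_left two_pos hweight)
  lia

theorem card_quotient_minimalCodeSetoid (hp : p.Prime) (hm : 0 < m)
    (hirr : Irreducible (cyclotomic (p ^ r) F)) (hG : IsHomocyclic (p ^ r) m G) :
    Nat.card (Quotient (minimalCodeSetoid F G)) = r + 1 := by
  have hminimal {I : Ideal (MonoidAlgebra F G)} := isMinimalCode_iff hp hm hirr hG (I := I)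
  obtain ⟨K, h, -, hs, -⟩ := exists_isSplitting_le_ker hp hm hG (1 : G →* ℚ)
  let code : Option (Fin r) → {I : Ideal (MonoidAlgebra F G) // IsMinimalCode I}
    | none => ⟨_, hminimal.2 (Or.inl rfl)⟩
    | some i => ⟨_, hminimal.2 (Or.inr ⟨K, h, i + 1, hs, Nat.le_add_left 1 i, i.2, rfl⟩)⟩
  have hinj : Function.Injective fun o => (⟦code o⟧ : Quotient (minimalCodeSetoid F G)) := by
    rintro (_ | i) (_ | j) hij
    · rfl
    · exact absurd (Quotient.exact hij) (not_gEquivalent_span_hat_top_span_rowIdempotent p K h _)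
    · exact absurd (GEquivalent.symm (Quotient.exact hij))
        (not_gEquivalent_span_hat_top_span_rowIdempotent p K h _)
    · exact congrArg some (Fin.ext (Nat.succ_injective
        (hs.eq_of_gEquivalent_span_rowIdempotent hp.one_lt (Nat.le_add_left 1 i) i.2
          (Nat.le_add_left 1 j) j.2 (Quotient.exact hij))))
  have hsurj : Function.Surjective fun o => (⟦code o⟧ : Quotient (minimalCodeSetoid F G)) := by
    refine Quotient.ind fun ⟨I, hI⟩ => ?_
    obtain rfl | ⟨K', h', i, hs', hi₁, hi, rfl⟩ := hminimal.1 hI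
    · exact ⟨none, rfl⟩
    · obtain ⟨j, rfl⟩ := Nat.exists_eq_add_of_le' hi₁
      exact ⟨some ⟨j, hi⟩, Quotient.sound (hs.gEquivalent_span_rowIdempotent hs' p (j + 1))⟩
  rw [← Nat.card_eq_of_bijective _ ⟨hinj, hsurj⟩, Finite.card_option, Nat.card_fin]

end Equivalence

section FiniteField

open Polynomial

variable {F : Type*} [Field F] [Finite F]

theorem natCast_ne_zero_of_coprime_card {n : ℕ} (h : (Nat.card F).Coprime n) : (n : F) ≠ 0 := by
  have := Fintype.ofFinite F
  have hcop : IsCoprime (n : F) (Nat.card F : F) := h.symm.cast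
  rw [Nat.card_eq_fintype_card, FiniteField.cast_card_eq_zero, isCoprime_zero_right] at hcop
  exact hcop.ne_zero

theorem irreducible_cyclotomic_of_orderOf_eq_totient {n : ℕ} (hn : (Nat.card F).Coprime n)
    (ho : orderOf (ZMod.unitOfCoprime (Nat.card F) hn) = n.totient) :
    Irreducible (cyclotomic n F) := by
  have := Fintype.ofFinite F
  obtain ⟨ℓ, hℓ⟩ := CharP.exists F
  obtain ⟨f, hprime, hcard⟩ := FiniteField.card F ℓ
  have : Fact ℓ.Prime := ⟨hprime⟩
  simp only [Nat.card_eq_fintype_card, hcard] at hn ho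
  refine irreducible_of_dvd_cyclotomic_of_natDegree hcard (hn.coprime_dvd_left
    (dvd_pow_self ℓ f.ne_zero)) dvd_rfl ?_
  rw [natDegree_cyclotomic, ho]

end FiniteField

end AbelianCodes

open AbelianCodes in
theorem mainTheorem11_general (p r m : ℕ) (hp : p.Prime) (hm : 0 < m)
    (F : Type*) [Field F] (hpF : (p : F) ≠ 0)
    (hirr : Irreducible (Polynomial.cyclotomic (p ^ r) F))
    (G : Type*) [CommGroup G] (hG : IsHomocyclic (p ^ r) m G) :
    (∀ e : MonoidAlgebra F G, IsPrimitiveIdempotent e ↔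
      e = hat F (⊤ : Subgroup G) ∨
      ∃ (K : Subgroup G) (h : G) (i : ℕ), IsSplitting (p ^ r) m K h ∧
        1 ≤ i ∧ i ≤ r ∧ e = rowIdempotent F p K h i) ∧
    (∀ I : Ideal (MonoidAlgebra F G), IsMinimalCode I ↔
      I = Ideal.span {hat F (⊤ : Subgroup G)} ∨
      ∃ (K : Subgroup G) (h : G) (i : ℕ), IsSplitting (p ^ r) m K h ∧
        1 ≤ i ∧ i ≤ r ∧ I = Ideal.span {rowIdempotent F p K h i}) ∧
    (codeDim (Ideal.span {hat F (⊤ : Subgroup G)}) = 1 ∧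
      HasWeight (Ideal.span {hat F (⊤ : Subgroup G)}) (p ^ (r * m))) ∧
    (∀ (K : Subgroup G) (h : G) (i : ℕ), IsSplitting (p ^ r) m K h →
      1 ≤ i → i ≤ r →
      codeDim (Ideal.span {rowIdempotent F p K h i}) = p ^ (i - 1) * (p - 1) ∧
        HasWeight (Ideal.span {rowIdempotent F p K h i}) (2 * p ^ (r * (m - 1) + (r - i)))) ∧
    (Nat.card (Quotient (minimalCodeSetoid F G)) = r + 1 ∧
      r + 1 = (Nat.divisors (p ^ r)).card) := by
  have hcard : Nat.card G = p ^ (r * m) := by rw [hG.card_eq, pow_mul]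
  have : NeZero (Nat.card G : F) := ⟨by rw [hcard, Nat.cast_pow]; exact pow_ne_zero _ hpF⟩
  refine ⟨fun _ => isPrimitiveIdempotent_iff_mem_codeIdempotents hp hm hirr hG,
    fun _ => isMinimalCode_iff hp hm hirr hG, ⟨codeDim_span_hat_top, ?_⟩,
    fun K h i hs hi₁ hi => ⟨?_, hs.hasWeight_span_rowIdempotent hp.one_lt hi₁ hi⟩,
    card_quotient_minimalCodeSetoid hp hm hirr hG, ?_⟩
  · rw [← hcard, ← Subgroup.card_top]
    exact hasWeight_span_hat
  · exact hs.codeDim_span_rowIdempotent hp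
      (Polynomial.cyclotomic_irreducible_pow_of_irreducible_pow hp hi hirr) hi₁ hi
  · rw [Nat.divisors_prime_pow hp, Finset.card_map, Finset.card_range]

theorem mainTheorem11 (p r m q : ℕ) (hp : p.Prime) (hr : 0 < r) (hm : 0 < m)
    (F : Type*) [Field F] [Finite F] (hF : Nat.card F = q)
    (hq : q.Coprime (p ^ r))
    (ho : orderOf (ZMod.unitOfCoprime q hq) = Nat.totient (p ^ r))
    (G : Type*) [CommGroup G] (hG : AbelianCodes.IsHomocyclic (p ^ r) m G) :
    -- the primitive idempotents of the group algebra
    (∀ e : MonoidAlgebra F G, AbelianCodes.IsPrimitiveIdempotent e ↔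
      e = AbelianCodes.hat F (⊤ : Subgroup G) ∨
      ∃ (K : Subgroup G) (h : G) (i : ℕ), AbelianCodes.IsSplitting (p ^ r) m K h ∧
        1 ≤ i ∧ i ≤ r ∧ e = AbelianCodes.rowIdempotent F p K h i) ∧
    -- the minimal codes are exactly the ideals generated by these idempotents
    (∀ I : Ideal (MonoidAlgebra F G), AbelianCodes.IsMinimalCode I ↔
      I = Ideal.span {AbelianCodes.hat F (⊤ : Subgroup G)} ∨
      ∃ (K : Subgroup G) (h : G) (i : ℕ), AbelianCodes.IsSplitting (p ^ r) m K h ∧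
        1 ≤ i ∧ i ≤ r ∧ I = Ideal.span {AbelianCodes.rowIdempotent F p K h i}) ∧
    -- dimensions and weights
    (AbelianCodes.codeDim (Ideal.span {AbelianCodes.hat F (⊤ : Subgroup G)}) = 1 ∧
      AbelianCodes.HasWeight (Ideal.span {AbelianCodes.hat F (⊤ : Subgroup G)}) (p ^ (r * m))) ∧
    (∀ (K : Subgroup G) (h : G) (i : ℕ), AbelianCodes.IsSplitting (p ^ r) m K h →
      1 ≤ i → i ≤ r →
      AbelianCodes.codeDim (Ideal.span {AbelianCodes.rowIdempotent F p K h i}) =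
          p ^ (i - 1) * (p - 1) ∧
        AbelianCodes.HasWeight (Ideal.span {AbelianCodes.rowIdempotent F p K h i})
          (2 * p ^ (r * (m - 1) + (r - i)))) ∧
    -- the number of classes of minimal codes under `G`-equivalence
    (Nat.card (Quotient (AbelianCodes.minimalCodeSetoid F G)) = r + 1 ∧
      r + 1 = (Nat.divisors (p ^ r)).card) := by
  subst hF
  exact mainTheorem11_general p r m hp hm F
    (AbelianCodes.natCast_ne_zero_of_coprime_card ((Nat.coprime_pow_right_iff hr _ _).1 hq))
    (AbelianCodes.irreducible_cyclotomic_of_orderOf_eq_totient hq ho) G hG
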